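/- Let $p$ be a prime and $n$ a natural number. Let $\mathbb{Z}[1/p]=\{a/p^m : a,m\in\mathbb{Z}\}$, let $UT_n(R)$ be the group of upper unitriangular $n\times n$ matrices over a commutative ring $R$, and let $G=\mathbb{Z}^n\ltimes UT_n(\mathbb{Z}[1/p])$ be the discrete group with multiplication $(x,f)(y,g)=(x+y,\,f\,XgX^{-1})$, where $X=\operatorname{diag}(p^{x_1},\dots,p^{x_n})$. Word length on $G$ is taken with respect to the finite generating set consisting of the elements $(e_r,I_n)$, $1\le r\le n$, and $(0,I_n+E_{rs})$, $1\le r<s\le n$, where $e_r$ are the standard basis vectors and $E_{rs}$ the matrix units. Let $\mu$ be a probability measure on $G$ that has finite first moment with respect to word length and is such that the group generated by $\operatorname{supp}\mu$ is non-abelian. For $1\le i,j\le n$ let $D_{ij}=\int_G x_i\,d\mu(x,f)-\int_G x_j\,d\mu(x,f)$; the entries $D_{ij}$ with $i<j$ are the displacements of $\mu$. Let $$(y^{(m)},\varphi^{(m)})=\prod_{l=1}^m (x^{(l)},f^{(l)}),\qquad m=1,2,\dots,$$ be the right random walk, where the increments $(x^{(l)},f^{(l)})$ are independent with law $\mu$;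 "almost surely" refers to the law of this sequence on $G^{\mathbb{N}}$. 1. Let $1\le i<j\le n$. If $D_{ij}<0$ and $D_{kj}$ has the same sign as $D_{ij}$ for every $k$ with $i<k<j$, then the sequence $\varphi^{(m)}_{ij}$ converges almost surely in $\mathbb{R}$. 2. If $D_{ij}<0$ for all $1\le i<j\le n$, then almost surely the matrices $\varphi^{(m)}$ converge entrywise to a matrix $\varphi^{(\infty)}\in UT_n(\mathbb{R})$. -/

import Mathlib

open MeasureTheory Filter Topology
open scoped ENNReal

namespace UTWalk

/-- The ring `ℤ[1/p] = {a / p ^ m : a ∈ ℤ, m ∈ ℕ}`, as a subring of `ℚ`. -/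
def pyadic (p : ℕ) [hp : Fact p.Prime] : Subring ℚ where
  carrier := {q | ∃ (a : ℤ) (m : ℕ), q = a / (p : ℚ) ^ m}
  zero_mem' := ⟨0, 0, by simp⟩
  one_mem' := ⟨1, 0, by simp⟩
  add_mem' := by
    rintro _ _ ⟨a, m, rfl⟩ ⟨b, k, rfl⟩
    have h : (p : ℚ) ≠ 0 := Nat.cast_ne_zero.2 hp.out.ne_zero
    refine ⟨a * p ^ k + b * p ^ m, m + k, ?_⟩
    push_cast
    field_simp
    ring
  mul_mem' := by
    rintro _ _ ⟨a, m, rfl⟩ ⟨b, k, rfl⟩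
    have h : (p : ℚ) ≠ 0 := Nat.cast_ne_zero.2 hp.out.ne_zero
    refine ⟨a * b, m + k, ?_⟩
    push_cast
    field_simp
    ring
  neg_mem' := by
    rintro _ ⟨a, m, rfl⟩
    exact ⟨-a, m, by push_cast; ring⟩

/-- The group `UT_n(R)` of upper unitriangular `n × n` matrices with entries in `R`. -/
def UT (n : ℕ) (R : Type*) [CommRing R] : Subgroup (GL (Fin n) R) where
  carrier := {f | (∀ i, (f : Matrix (Fin n) (Fin n) R) i i = 1) ∧
    ∀ i j, j < i → (f : Matrix (Fin n) (Fin n) R) i j = 0}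
  one_mem' := ⟨fun i => by simp, fun i j h => by simp [Matrix.one_apply_ne h.ne']⟩
  mul_mem' := by
    rintro f g ⟨hf, hf'⟩ ⟨hg, hg'⟩
    refine ⟨fun i => ?_, fun i j hij => ?_⟩
    · rw [Units.val_mul, Matrix.mul_apply, Finset.sum_eq_single i]
      · rw [hf, hg, one_mul]
      · intro k _ hk
        rcases lt_or_gt_of_ne hk with h | h
        · rw [hf' i k h, zero_mul]
        · rw [hg' k i h, mul_zero]
      · simp
    · rw [Units.val_mul, Matrix.mul_apply]
      refine Finset.sum_eq_zero fun k _ => ?_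
      rcases lt_or_ge k i with h | h
      · rw [hf' i k h, zero_mul]
      · rw [hg' k j (hij.trans_le h), mul_zero]
  inv_mem' := by
    rintro f ⟨hf, hf'⟩
    have ht : ∀ i j, j < i → ((f⁻¹ : GL (Fin n) R) : Matrix (Fin n) (Fin n) R) i j = 0 := by
      have hb : Matrix.BlockTriangular (f : Matrix (Fin n) (Fin n) R) id :=
        fun i j h => hf' i j h
      have : Invertible (f : Matrix (Fin n) (Fin n) R) := Units.invertible f
      have := Matrix.blockTriangular_inv_of_blockTriangular hb
      intro i j h
      rw [Matrix.coe_units_inv]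
      exact this h
    refine ⟨fun i => ?_, ht⟩
    have h1 : ((f : Matrix (Fin n) (Fin n) R) *
        ((f⁻¹ : GL (Fin n) R) : Matrix (Fin n) (Fin n) R)) i i = 1 := by
      rw [← Units.val_mul, mul_inv_cancel, Units.val_one, Matrix.one_apply_eq]
    rw [Matrix.mul_apply, Finset.sum_eq_single i, hf, one_mul] at h1
    · exact h1
    · intro k _ hk
      rcases lt_or_gt_of_ne hk with h | h
      · rw [hf' i k h, zero_mul]
      · rw [ht k i h, mul_zero]
    · simp

/-- The `(i, j)` entry of a unitriangular matrix. -/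
def entry {n : ℕ} {R : Type*} [CommRing R] (f : UT n R) (i j : Fin n) : R :=
  ((f : GL (Fin n) R) : Matrix (Fin n) (Fin n) R) i j

/-- The elementary matrix `θ_{rs}(1)`, `r < s`: the identity with an additional `1` at `(r, s)`. -/
noncomputable def theta {n : ℕ} (R : Type*) [CommRing R] (r s : Fin n) (h : r < s) : UT n R :=
  ⟨Matrix.GeneralLinearGroup.mk'' (Matrix.transvection r s (1 : R))
      (by rw [Matrix.det_transvection_of_ne r s h.ne]; exact isUnit_one), by
    refine ⟨fun i => ?_, fun i j hij => ?_⟩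
    · change Matrix.transvection r s (1 : R) i i = 1
      have : ¬ (r = i ∧ s = i) := fun ⟨h1, h2⟩ => h.ne (h1.trans h2.symm)
      simp [Matrix.transvection, this]
    · change Matrix.transvection r s (1 : R) i j = 0
      have : ¬ (r = i ∧ s = j) := fun ⟨h1, h2⟩ => by subst h1 h2; exact absurd h hij.not_gt
      simp [Matrix.transvection, this, Matrix.one_apply_ne hij.ne']⟩

/-- The prime `p` as a unit of `ℤ[1/p]`. -/
def pUnit (p : ℕ) [hp : Fact p.Prime] : (pyadic p)ˣ where
  val := ⟨p, p, 0, by simp⟩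
  inv := ⟨(p : ℚ)⁻¹, 1, 1, by simp⟩
  val_inv := Subtype.ext (mul_inv_cancel₀ (Nat.cast_ne_zero.2 hp.out.ne_zero))
  inv_val := Subtype.ext (inv_mul_cancel₀ (Nat.cast_ne_zero.2 hp.out.ne_zero))

/-- The diagonal matrix `X = diag(p ^ x₁, …, p ^ xₙ)` attached to `x ∈ ℤⁿ`. -/
def diagMat (n p : ℕ) [Fact p.Prime] : Multiplicative (Fin n → ℤ) →* GL (Fin n) (pyadic p) where
  toFun x :=
    { val := Matrix.diagonal fun i => ((pUnit p ^ (x.toAdd i) : (pyadic p)ˣ) : pyadic p)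
      inv := Matrix.diagonal fun i => ((pUnit p ^ (-x.toAdd i) : (pyadic p)ˣ) : pyadic p)
      val_inv := by
        rw [Matrix.diagonal_mul_diagonal, ← Matrix.diagonal_one]
        congr 1; funext i
        rw [← Units.val_mul, ← zpow_add]; simp
      inv_val := by
        rw [Matrix.diagonal_mul_diagonal, ← Matrix.diagonal_one]
        congr 1; funext i
        rw [← Units.val_mul, ← zpow_add]; simp }
  map_one' := Units.ext <| by
    simp only [toAdd_one, Pi.zero_apply, zpow_zero, Units.val_one]
    exact Matrix.diagonal_one
  map_mul' x y := Units.ext <| by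
    rw [Units.val_mul]
    simp only [Matrix.diagonal_mul_diagonal]
    congr 1; funext i
    rw [← Units.val_mul, ← zpow_add, toAdd_mul, Pi.add_apply]

theorem conj_diagMat_apply (n p : ℕ) [Fact p.Prime] (x : Multiplicative (Fin n → ℤ))
    (f : GL (Fin n) (pyadic p)) (i j : Fin n) :
    ((diagMat n p x * f * (diagMat n p x)⁻¹ : GL (Fin n) (pyadic p)) :
        Matrix (Fin n) (Fin n) (pyadic p)) i j =
      ((pUnit p ^ (x.toAdd i) : (pyadic p)ˣ) : pyadic p) *
        (f : Matrix (Fin n) (Fin n) (pyadic p)) i j *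
        ((pUnit p ^ (-x.toAdd j) : (pyadic p)ˣ) : pyadic p) := by
  rw [Units.val_mul, Units.val_mul]
  change ((Matrix.diagonal fun i => ((pUnit p ^ (x.toAdd i) : (pyadic p)ˣ) : pyadic p)) *
    (f : Matrix (Fin n) (Fin n) (pyadic p)) *
    (Matrix.diagonal fun i => ((pUnit p ^ (-x.toAdd i) : (pyadic p)ˣ) : pyadic p)) :
      Matrix (Fin n) (Fin n) (pyadic p)) i j = _
  rw [Matrix.mul_diagonal, Matrix.diagonal_mul]

theorem conj_diagMat_mem (n p : ℕ) [Fact p.Prime] (x : Multiplicative (Fin n → ℤ))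
    {f : GL (Fin n) (pyadic p)} (hf : f ∈ UT n (pyadic p)) :
    diagMat n p x * f * (diagMat n p x)⁻¹ ∈ UT n (pyadic p) := by
  refine ⟨fun i => ?_, fun i j hij => ?_⟩
  · rw [conj_diagMat_apply, hf.1 i, mul_one, ← Units.val_mul, ← zpow_add]; simp
  · rw [conj_diagMat_apply, hf.2 i j hij]; simp

/-- The action `ζ_x(f) = X f X⁻¹` of `ℤⁿ` on `UT_n(ℤ[1/p])`. -/
def zeta (n p : ℕ) [Fact p.Prime] :
    Multiplicative (Fin n → ℤ) →* MulAut (UT n (pyadic p)) where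
  toFun x :=
    { toFun := fun f => ⟨diagMat n p x * f * (diagMat n p x)⁻¹, conj_diagMat_mem n p x f.2⟩
      invFun := fun f => ⟨diagMat n p x⁻¹ * f * (diagMat n p x⁻¹)⁻¹,
        conj_diagMat_mem n p x⁻¹ f.2⟩
      left_inv := fun f => Subtype.ext <| by simp only [map_inv]; group
      right_inv := fun f => Subtype.ext <| by simp only [map_inv]; group
      map_mul' := fun f g => Subtype.ext <| by simp only [Subgroup.coe_mul]; group }
  map_one' := by ext1 f; exact Subtype.ext (by simp)
  map_mul' x y := by
    ext1 f
    refine Subtype.ext ?_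
    change diagMat n p (x * y) * (f : GL (Fin n) (pyadic p)) * (diagMat n p (x * y))⁻¹ =
      diagMat n p x * (diagMat n p y * f * (diagMat n p y)⁻¹) * (diagMat n p x)⁻¹
    rw [map_mul]; group

/-- The group `G = ℤⁿ ⋉ UT_n(ℤ[1/p])`, with `(x, f) (y, g) = (x + y, f ζ_x(g))`.
In Mathlib's notation the element `(x, f)` has `left = f` and `right = x`. -/
abbrev G (n p : ℕ) [Fact p.Prime] : Type :=
  SemidirectProduct (UT n (pyadic p)) (Multiplicative (Fin n → ℤ)) (zeta n p)

/-- `G` is a discrete group: every subset is measurable. -/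
instance (n p : ℕ) [Fact p.Prime] : MeasurableSpace (G n p) := ⊤

instance (n p : ℕ) [Fact p.Prime] : DiscreteMeasurableSpace (G n p) := ⟨fun _ => trivial⟩

instance (n p : ℕ) [Fact p.Prime] : Countable (G n p) := by
  have h1 : Countable (pyadic p) := inferInstance
  have h2 : Countable (Matrix (Fin n) (Fin n) (pyadic p)) :=
    inferInstanceAs (Countable (Fin n → Fin n → pyadic p))
  have h3 : Countable (GL (Fin n) (pyadic p)) := Units.val_injective.countable
  have h4 : Countable (Multiplicative (Fin n → ℤ)) := inferInstanceAs (Countable (Fin n → ℤ))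
  exact (SemidirectProduct.equivProd (φ := zeta n p)).injective.countable

/-- The standard finite generating set of `G`: the elements `(e_r, I)`, which correspond to the
diagonal matrices `θ_{rr}(p)`, and the elements `(0, θ_{rs}(1))` with `r < s`. -/
def gens (n p : ℕ) [Fact p.Prime] : Set (G n p) :=
  {g | ∃ r : Fin n, g = SemidirectProduct.inr (Multiplicative.ofAdd (Pi.single r (1 : ℤ)))} ∪
  {g | ∃ (r s : Fin n) (h : r < s), g = SemidirectProduct.inl (theta (pyadic p) r s h)}

/-- Word length of `g` with respect to `S`: the least length of a word in `S ∪ S⁻¹` with value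
`g` (and `⊤` if there is no such word). -/
noncomputable def wordLength {H : Type*} [Group H] (S : Set H) (g : H) : ℕ∞ :=
  ⨅ (l : List H) (_ : (∀ s ∈ l, s ∈ S ∨ s⁻¹ ∈ S) ∧ l.prod = g), (l.length : ℕ∞)

/-- `μ` has finite first moment with respect to word length. -/
def FiniteFirstMoment {n p : ℕ} [Fact p.Prime] (μ : Measure (G n p)) : Prop :=
  ∫⁻ g, (wordLength (gens n p) g : ℝ≥0∞) ∂μ < ∞

/-- The group generated by the support of `μ` (a measure on a countable discrete group) is not
abelian. -/
def NonabelianSupport {n p : ℕ} [Fact p.Prime] (μ : Measure (G n p)) : Prop :=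
  ∃ a ∈ Subgroup.closure {g : G n p | μ {g} ≠ 0},
    ∃ b ∈ Subgroup.closure {g : G n p | μ {g} ≠ 0}, a * b ≠ b * a

/-- The projection `(x, f) ↦ x_i`. -/
def hProj {n p : ℕ} [Fact p.Prime] (i : Fin n) (g : G n p) : ℤ := g.right.toAdd i

/-- The mean of the pushforward of `μ` under `(x, f) ↦ x_i`. -/
noncomputable def mean {n p : ℕ} [Fact p.Prime] (μ : Measure (G n p)) (i : Fin n) : ℝ :=
  ∫ z, (z : ℝ) ∂(μ.map (hProj i))

/-- The displacement matrix of `μ`. -/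
noncomputable def displacement {n p : ℕ} [Fact p.Prime] (μ : Measure (G n p)) :
    Matrix (Fin n) (Fin n) ℝ :=
  Matrix.of fun i j => mean μ i - mean μ j

/-- The map `S(ω₁, ω₂, …) = (ω₁, ω₁ω₂, ω₁ω₂ω₃, …)`, with indices shifted to start at `0`. -/
def partialProducts {H : Type*} [Group H] (ω : ℕ → H) : ℕ → H
  | 0 => ω 0
  | m + 1 => partialProducts ω m * ω (m + 1)

theorem measurable_partialProducts (n p : ℕ) [Fact p.Prime] :
    Measurable (partialProducts : (ℕ → G n p) → ℕ → G n p) := by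
  refine measurable_pi_lambda _ fun m => ?_
  induction m with
  | zero => exact measurable_pi_apply 0
  | succ m ih =>
    exact (measurable_of_countable fun q : G n p × G n p => q.1 * q.2).comp
      (ih.prodMk (measurable_pi_apply (m + 1)))

/-- The path measure: the image of `μ^ℕ` under `S`, i.e. the law of the right random walk. -/
noncomputable def pathMeasure {n p : ℕ} [Fact p.Prime] (μ : Measure (G n p)) :
    Measure (ℕ → G n p) :=
  (Measure.infinitePi fun _ : ℕ => μ).map partialProducts

instance {n p : ℕ} [Fact p.Prime] (μ : Measure (G n p)) [IsProbabilityMeasure μ] :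
    IsProbabilityMeasure (pathMeasure μ) :=
  Measure.isProbabilityMeasure_map (measurable_partialProducts n p).aemeasurable

/-- The entry `φ_{ij}` of the unitriangular part of `(x, φ) ∈ G`, as a real number. -/
def realEntry {n p : ℕ} [Fact p.Prime] (g : G n p) (i j : Fin n) : ℝ :=
  (((entry g.left i j : pyadic p) : ℚ) : ℝ)

end UTWalk

/-! Write `d k` for the mean of `x_k`. Multiplying by one more increment changes `φ_ij` by the sum
over `i ≤ l < j` of `φ_il · p ^ (y_l - y_j) · f_lj` (`realEntry_mul_sub`). By the strong law `y_k /
m → d k`, so `p ^ (y_l - y_j)` has exponential rate `log p · (d l - d j)`. The entries of `f` are at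
most exponential in its word length, which is almost surely `o(m)` by the first moment, so they have
rate `0`.

Let `d k₀` be the largest `d k` with `i ≤ k < j`. By induction on the column, `φ_ik` has rate at
most `log p · (d k₀ - d k)`: the rates telescope, and summing increments preserves a nonnegative
rate (`GrowthRate.of_sub`). In column `j` the rate of the increments is negative, because `D_kj < 0`
for all `i ≤ k < j`; hence they are summable (`GrowthRate.exists_tendsto`). Everything random is
confined to the strong law; `exists_tendsto_realEntry` works along a fixed path. -/

namespace UTWalk

/-! ### Entries of products and their growth in the word length. -/

section Algebra

variable {n p : ℕ} [Fact p.Prime]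

theorem coe_pUnit_zpow (z : ℤ) :
    ((((pUnit p ^ z : (pyadic p)ˣ) : pyadic p) : ℚ) : ℝ) = (p : ℝ) ^ z := by
  have h := map_zpow (Units.map (pyadic p).subtype.toMonoidHom) (pUnit p) z
  have h2 := congrArg (fun u : ℚˣ => (u : ℚ)) h
  simp only [Units.val_zpow_eq_zpow_val] at h2
  have h3 : (((pUnit p ^ z : (pyadic p)ˣ) : pyadic p) : ℚ) = (p : ℚ) ^ z := h2
  rw [h3]
  push_cast
  rfl

theorem realEntry_mul (a b : G n p) (i j : Fin n) :
    realEntry (a * b) i j =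
      ∑ k, realEntry a i k * (p : ℝ) ^ (hProj k a - hProj j a) * realEntry b k j := by
  have hp : (p : ℝ) ≠ 0 := Nat.cast_ne_zero.2 (Fact.out : p.Prime).ne_zero
  have h : entry (a * b).left i j = ∑ k, entry a.left i k *
      (((pUnit p ^ (hProj k a) : (pyadic p)ˣ) : pyadic p) * entry b.left k j *
        ((pUnit p ^ (-hProj j a) : (pyadic p)ˣ) : pyadic p)) := by
    rw [SemidirectProduct.mul_left]
    unfold entry
    rw [Subgroup.coe_mul, Units.val_mul, Matrix.mul_apply]
    refine Finset.sum_congr rfl fun k _ => ?_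
    congr 1
    exact conj_diagMat_apply n p a.right b.left k j
  unfold realEntry
  rw [h]
  push_cast
  refine Finset.sum_congr rfl fun k _ => ?_
  rw [coe_pUnit_zpow, coe_pUnit_zpow, sub_eq_add_neg, zpow_add₀ hp]
  ring

theorem hProj_mul (a b : G n p) (i : Fin n) : hProj i (a * b) = hProj i a + hProj i b := rfl

theorem realEntry_self (a : G n p) (i : Fin n) : realEntry a i i = 1 := by
  unfold realEntry entry
  rw [a.left.2.1 i]
  simp

theorem realEntry_of_lt (a : G n p) {i j : Fin n} (h : j < i) : realEntry a i j = 0 := by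
  unfold realEntry entry
  rw [a.left.2.2 i j h]
  simp

theorem gens_finite (n p : ℕ) [Fact p.Prime] : (gens n p).Finite := by
  refine Set.Finite.union ?_ ?_
  · refine (Set.finite_range fun r : Fin n =>
      (SemidirectProduct.inr (Multiplicative.ofAdd (Pi.single r (1 : ℤ))) : G n p)).subset ?_
    rintro _ ⟨r, rfl⟩
    exact ⟨r, rfl⟩
  · refine (Set.finite_range fun q : {q : Fin n × Fin n // q.1 < q.2} =>
      (SemidirectProduct.inl (theta (pyadic p) q.1.1 q.1.2 q.2) : G n p)).subset ?_
    rintro _ ⟨r, s, h, rfl⟩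
    exact ⟨⟨(r, s), h⟩, rfl⟩

/-- The second quantity is the coefficient of `realEntry b k j` in `realEntry_mul` for a product `s
* b`. Finitely many generators and inverses allow one common bound. -/
theorem exists_gens_bound (n p : ℕ) [Fact p.Prime] : ∃ K : ℝ, 1 ≤ K ∧ ∀ s : G n p,
    s ∈ gens n p ∨ s⁻¹ ∈ gens n p →
      (∀ i, |(hProj i s : ℝ)| ≤ K) ∧
      ∀ i j k, |realEntry s i k * (p : ℝ) ^ (hProj k s - hProj j s)| ≤ K := by
  have hfin : (gens n p ∪ (gens n p)⁻¹).Finite := (gens_finite n p).union (gens_finite n p).inv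
  have h : ∀ i j k : Fin n, ∃ K : ℝ, ∀ s ∈ gens n p ∪ (gens n p)⁻¹,
      |(hProj i s : ℝ)| + |realEntry s i k * (p : ℝ) ^ (hProj k s - hProj j s)| ≤ K := by
    intro i j k
    obtain ⟨K, hK⟩ := (hfin.image fun s => |(hProj i s : ℝ)| +
      |realEntry s i k * (p : ℝ) ^ (hProj k s - hProj j s)|).bddAbove
    exact ⟨K, fun s hs => hK ⟨s, hs, rfl⟩⟩
  choose K hK using h
  have hle : ∀ i j k, K i j k ≤ 1 + ∑ i, ∑ j, ∑ k, |K i j k| := by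
    intro i j k
    have h1 : |K i j k| ≤ ∑ k, |K i j k| :=
      Finset.single_le_sum (f := fun k => |K i j k|) (fun _ _ => abs_nonneg _) (Finset.mem_univ k)
    have h2 : ∑ k, |K i j k| ≤ ∑ j, ∑ k, |K i j k| :=
      Finset.single_le_sum (f := fun j => ∑ k, |K i j k|)
        (fun _ _ => Finset.sum_nonneg fun _ _ => abs_nonneg _) (Finset.mem_univ j)
    have h3 : ∑ j, ∑ k, |K i j k| ≤ ∑ i, ∑ j, ∑ k, |K i j k| :=
      Finset.single_le_sum (f := fun i => ∑ j, ∑ k, |K i j k|)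
        (fun _ _ => Finset.sum_nonneg fun _ _ => Finset.sum_nonneg fun _ _ => abs_nonneg _)
        (Finset.mem_univ i)
    linarith [le_abs_self (K i j k)]
  refine ⟨1 + ∑ i, ∑ j, ∑ k, |K i j k|, ?_, fun s hs => ⟨fun i => ?_, fun i j k => ?_⟩⟩
  · have : 0 ≤ ∑ i, ∑ j, ∑ k, |K i j k| :=
      Finset.sum_nonneg fun _ _ => Finset.sum_nonneg fun _ _ => Finset.sum_nonneg fun _ _ =>
        abs_nonneg _
    linarith
  · have h1 := hK i i i s hs
    have h2 := hle i i i
    linarith [abs_nonneg (realEntry s i i * (p : ℝ) ^ (hProj i s - hProj i s))]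
  · have h1 := hK i j k s hs
    have h2 := hle i j k
    linarith [abs_nonneg (hProj i s : ℝ)]

/-- The coordinates `x_i` grow at most linearly, and the entries of the unitriangular part at most
exponentially, in the word length. -/
theorem exists_wordLength_bound (n p : ℕ) [Fact p.Prime] : ∃ K A : ℝ, 0 ≤ K ∧ 1 ≤ A ∧
    ∀ (g : G n p) (L : ℕ), wordLength (gens n p) g = L →
      (∀ i, |(hProj i g : ℝ)| ≤ K * L) ∧ ∀ i j, |realEntry g i j| ≤ A ^ L := by
  obtain ⟨K, hK1, hK⟩ := exists_gens_bound n p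
  -- Prepending a letter gives `n` terms, each with coefficient at most `K`; the extra `1` makes the
  -- base at least `1`, so its powers increase with the exponent.
  have hA : 1 ≤ n * K + 1 := by nlinarith [Nat.cast_nonneg (α := ℝ) n]
  have key : ∀ l : List (G n p), (∀ s ∈ l, s ∈ gens n p ∨ s⁻¹ ∈ gens n p) →
      (∀ i, |(hProj i l.prod : ℝ)| ≤ K * l.length) ∧
        ∀ i j, |realEntry l.prod i j| ≤ (n * K + 1) ^ l.length := by
    intro l
    induction l with
    | nil =>
      intro _
      refine ⟨fun i => by simp [hProj], fun i j => ?_⟩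
      rcases eq_or_ne i j with rfl | h
      · simp [realEntry_self]
      · simp [realEntry, entry, Matrix.one_apply_ne h]
    | cons s t ih =>
      intro hl
      obtain ⟨ih1, ih2⟩ := ih fun s hs => hl s (List.mem_cons_of_mem _ hs)
      obtain ⟨h1, h2⟩ := hK s (hl s List.mem_cons_self)
      rw [List.prod_cons]
      refine ⟨fun i => ?_, fun i j => ?_⟩
      · rw [hProj_mul, List.length_cons]
        push_cast
        linarith [abs_add_le (hProj i s : ℝ) (hProj i t.prod : ℝ), h1 i, ih1 i]
      · rw [realEntry_mul, List.length_cons, pow_succ]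
        have hpow : 0 ≤ (n * K + 1) ^ t.length := by positivity
        calc _ ≤ ∑ k, |realEntry s i k * (p : ℝ) ^ (hProj k s - hProj j s) *
                realEntry t.prod k j| := Finset.abs_sum_le_sum_abs _ _
          _ ≤ ∑ _k : Fin n, K * (n * K + 1) ^ t.length := by
              refine Finset.sum_le_sum fun k _ => ?_
              rw [abs_mul]
              exact mul_le_mul (h2 i j k) (ih2 k j) (abs_nonneg _) (by linarith)
          _ ≤ _ := by
              rw [Finset.sum_const, Finset.card_univ, Fintype.card_fin, nsmul_eq_mul]
              linarith
  refine ⟨K, n * K + 1, by linarith, hA, fun g L hg => ?_⟩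
  -- A strict bound on the infimum produces an actual word, of length at most `L`.
  have hlt : wordLength (gens n p) g < (L + 1 : ℕ) := by
    rw [hg]; exact_mod_cast Nat.lt_succ_self L
  unfold wordLength at hlt
  simp only [iInf_lt_iff] at hlt
  obtain ⟨l, ⟨hl, rfl⟩, hlen⟩ := hlt
  have hlen' : l.length ≤ L := Nat.lt_succ_iff.1 (by exact_mod_cast hlen)
  obtain ⟨h1, h2⟩ := key l hl
  refine ⟨fun i => (h1 i).trans ?_, fun i j => (h2 i j).trans (pow_le_pow_right₀ hA hlen')⟩
  have : (l.length : ℝ) ≤ L := by exact_mod_cast hlen'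
  exact mul_le_mul_of_nonneg_left this (by linarith)

end Algebra

/-! ### Calculus of exponential growth rates. -/

section Growth

/-- `a m` is `O(exp ((r + ε) m))` for every `ε > 0`. -/
def GrowthRate (a : ℕ → ℝ) (r : ℝ) : Prop :=
  ∀ ε > 0, ∃ C > 0, ∀ m : ℕ, |a m| ≤ C * Real.exp ((r + ε) * m)

namespace GrowthRate

variable {a b : ℕ → ℝ} {r s : ℝ}

theorem mono (h : GrowthRate a r) (hrs : r ≤ s) : GrowthRate a s := by
  intro ε hε
  obtain ⟨C, hC, hb⟩ := h ε hε
  refine ⟨C, hC, fun m => (hb m).trans ?_⟩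
  gcongr

theorem mul (ha : GrowthRate a r) (hb : GrowthRate b s) :
    GrowthRate (fun m => a m * b m) (r + s) := by
  intro ε hε
  obtain ⟨C, hC, h1⟩ := ha (ε / 2) (half_pos hε)
  obtain ⟨D, hD, h2⟩ := hb (ε / 2) (half_pos hε)
  refine ⟨C * D, mul_pos hC hD, fun m => ?_⟩
  rw [abs_mul]
  calc |a m| * |b m| ≤ (C * Real.exp ((r + ε / 2) * m)) * (D * Real.exp ((s + ε / 2) * m)) :=
        mul_le_mul (h1 m) (h2 m) (abs_nonneg _) (by positivity)
    _ = C * D * (Real.exp ((r + ε / 2) * m) * Real.exp ((s + ε / 2) * m)) := by ring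
    _ = _ := by rw [← Real.exp_add]; ring_nf

theorem zero : GrowthRate (fun _ => 0) r := fun ε _ =>
  ⟨1, one_pos, fun m => by simp [Real.exp_nonneg]⟩

theorem add (ha : GrowthRate a r) (hb : GrowthRate b r) :
    GrowthRate (fun m => a m + b m) r := by
  intro ε hε
  obtain ⟨C, hC, h1⟩ := ha ε hε
  obtain ⟨D, hD, h2⟩ := hb ε hε
  refine ⟨C + D, add_pos hC hD, fun m => ?_⟩
  linarith [abs_add_le (a m) (b m), h1 m, h2 m]

theorem sum {ι : Type*} {S : Finset ι} {f : ι → ℕ → ℝ} (h : ∀ i ∈ S, GrowthRate (f i) r) :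
    GrowthRate (fun m => ∑ i ∈ S, f i m) r := by
  classical
  induction S using Finset.induction_on with
  | empty => simpa using zero
  | insert i S hi ih =>
    simp only [Finset.sum_insert hi]
    exact (h i (Finset.mem_insert_self i S)).add
      (ih fun k hk => h k (Finset.mem_insert_of_mem hk))

theorem of_log_le {u : ℕ → ℝ} (h : ∀ m, |a m| ≤ Real.exp (u m))
    (hu : Tendsto (fun m : ℕ => u m / m) atTop (𝓝 r)) : GrowthRate a r := by
  intro ε hε
  have h1 : ∀ᶠ m : ℕ in atTop, ‖a m‖ ≤ 1 * ‖Real.exp ((r + ε) * m)‖ := by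
    filter_upwards [hu.eventually (gt_mem_nhds (lt_add_of_pos_right r hε)), eventually_gt_atTop 0]
      with m hm hm0
    have : (0 : ℝ) < m := by exact_mod_cast hm0
    rw [div_lt_iff₀ this] at hm
    rw [one_mul, Real.norm_eq_abs, Real.norm_eq_abs, Real.abs_exp]
    exact (h m).trans (Real.exp_le_exp.2 hm.le)
  -- Since `exp` never vanishes, enlarging the constant absorbs the finitely many exceptional `m`.
  obtain ⟨C, hC, hb⟩ := Asymptotics.bound_of_isBigO_nat_atTop (Asymptotics.IsBigO.of_bound 1 h1)
  refine ⟨C, hC, fun m => ?_⟩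
  have := hb (x := m) (Real.exp_ne_zero _)
  rwa [Real.norm_eq_abs, Real.norm_eq_abs, Real.abs_exp] at this

/-- A geometric sum of ratio `exp (r + ε) > 1` is comparable to its last term; this is where `0 ≤ r`
enters. -/
theorem of_sub (hr : 0 ≤ r) (h : GrowthRate (fun m => a (m + 1) - a m) r) : GrowthRate a r := by
  intro ε hε
  obtain ⟨C, hC, hb⟩ := h ε hε
  have hR : 0 < Real.exp (r + ε) - 1 := by
    have := Real.add_one_lt_exp (x := r + ε) (by linarith)
    linarith
  refine ⟨|a 0| + C / (Real.exp (r + ε) - 1), by positivity, fun m => ?_⟩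
  induction m with
  | zero =>
    have : 0 ≤ C / (Real.exp (r + ε) - 1) := by positivity
    simpa using this
  | succ m ih =>
    set D := |a 0| + C / (Real.exp (r + ε) - 1) with hD
    -- `D` is chosen so that `D + C ≤ D * exp (r + ε)`, which closes the induction.
    have hCD : C ≤ D * (Real.exp (r + ε) - 1) := by
      rw [hD, add_mul, div_mul_cancel₀ _ hR.ne']
      nlinarith [abs_nonneg (a 0)]
    have e : Real.exp ((r + ε) * (m + 1 : ℕ)) = Real.exp ((r + ε) * m) * Real.exp (r + ε) := by
      rw [← Real.exp_add]; push_cast; ring_nf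
    rw [e]
    have h1 : |a (m + 1)| ≤ |a m| + |a (m + 1) - a m| := by
      have := abs_add_le (a m) (a (m + 1) - a m)
      rwa [add_sub_cancel] at this
    have h2 := hb m
    have h3 := mul_le_mul_of_nonneg_right hCD (Real.exp_nonneg ((r + ε) * m))
    nlinarith

theorem exists_tendsto (hr : r < 0) (h : GrowthRate (fun m => a (m + 1) - a m) r) :
    ∃ l, Tendsto a atTop (𝓝 l) := by
  -- This `ε` leaves the exponent `r / 2 < 0`, so the increments decay geometrically.
  obtain ⟨C, -, hb⟩ := h (-r / 2) (by linarith)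
  refine cauchySeq_tendsto_of_complete
    (cauchySeq_of_le_geometric (Real.exp (r / 2)) C (Real.exp_lt_one_iff.2 (by linarith)) fun m => ?_)
  rw [dist_comm, Real.dist_eq, ← Real.exp_nat_mul]
  refine (hb m).trans_eq ?_
  ring_nf

end GrowthRate

end Growth

/-! ### Convergence along a single path. -/

section Deterministic

variable {n p : ℕ} [Fact p.Prime]

theorem realEntry_mul_sub (a b : G n p) {i k : Fin n} (hik : i ≤ k) :
    realEntry (a * b) i k - realEntry a i k =
      ∑ l ∈ Finset.Ico i k,
        realEntry a i l * (p : ℝ) ^ (hProj l a - hProj k a) * realEntry b l k := by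
  -- Triangularity cuts the sum down to `i ≤ l ≤ k`, and the term `l = k` is `realEntry a i k`.
  rw [realEntry_mul, ← Finset.sum_subset (Finset.subset_univ (Finset.Icc i k)),
    ← Finset.Ico_insert_right hik, Finset.sum_insert Finset.right_notMem_Ico]
  · simp [realEntry_self]
  · intro l _ hl
    rcases lt_or_ge l i with h | h
    · simp [realEntry_of_lt a h]
    · have : k < l := by
        by_contra hkl
        exact hl (Finset.mem_Icc.2 ⟨h, not_lt.1 hkl⟩)
      simp [realEntry_of_lt b this]

/-- Convergence of an entry along a path whose abelian coordinates have linear speeds `d` and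
whose increments grow subexponentially. -/
theorem exists_tendsto_realEntry (P ω : ℕ → G n p) (hP : ∀ m, P (m + 1) = P m * ω (m + 1))
    (d : Fin n → ℝ) (hd : ∀ i, Tendsto (fun m : ℕ => (hProj i (P m) : ℝ) / m) atTop (𝓝 (d i)))
    (hω : ∀ k l, GrowthRate (fun m => realEntry (ω (m + 1)) k l) 0)
    {i j : Fin n} (hij : i < j) (h : ∀ k, i ≤ k → k < j → d k < d j) :
    ∃ l, Tendsto (fun m => realEntry (P m) i j) atTop (𝓝 l) := by
  have hp1 : (1 : ℝ) < p := by exact_mod_cast (Fact.out : p.Prime).one_lt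
  have hc : 0 < Real.log p := Real.log_pos hp1
  have hpow : ∀ k l, GrowthRate (fun m => (p : ℝ) ^ (hProj k (P m) - hProj l (P m)))
      (Real.log p * (d k - d l)) := by
    intro k l
    refine .of_log_le (u := fun m => Real.log p * ((hProj k (P m) : ℝ) - hProj l (P m)))
      (fun m => ?_) ?_
    · rw [abs_of_pos (by positivity), ← Real.rpow_intCast, Real.rpow_def_of_pos (by linarith)]
      push_cast
      exact le_rfl
    · refine (((hd k).sub (hd l)).const_mul (Real.log p)).congr fun m => ?_
      ring
  obtain ⟨k₀, hk₀, hmax⟩ := Finset.exists_max_image (Finset.Ico i j) d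
    ⟨i, Finset.mem_Ico.2 ⟨le_rfl, hij⟩⟩
  obtain ⟨hik₀, hk₀j⟩ := Finset.mem_Ico.1 hk₀
  -- The rates telescope: `(d k₀ - d l) + (d l - d k) + 0 = d k₀ - d k`, independently of `l`.
  have hstep : ∀ k, i ≤ k → (∀ l ∈ Finset.Ico i k,
      GrowthRate (fun m => realEntry (P m) i l) (Real.log p * (d k₀ - d l))) →
      GrowthRate (fun m => realEntry (P (m + 1)) i k - realEntry (P m) i k)
        (Real.log p * (d k₀ - d k)) := by
    intro k hik hl
    simp only [hP, realEntry_mul_sub _ _ hik]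
    refine GrowthRate.sum fun l hlk => ?_
    exact (((hl l hlk).mul (hpow l k)).mul (hω l k)).mono (le_of_eq (by ring))
  have hgrow : ∀ k, i ≤ k → k < j →
      GrowthRate (fun m => realEntry (P m) i k) (Real.log p * (d k₀ - d k)) := by
    intro k
    induction k using WellFoundedLT.induction with
    | ind k ih =>
      intro hik hkj
      -- Maximality of `d k₀` makes the rate nonnegative.
      refine .of_sub (mul_nonneg hc.le (sub_nonneg.2 (hmax k (Finset.mem_Ico.2 ⟨hik, hkj⟩)))) ?_
      refine hstep k hik fun l hl => ?_
      obtain ⟨h1, h2⟩ := Finset.mem_Ico.1 hl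
      exact ih l h2 h1 (h2.trans hkj)
  refine GrowthRate.exists_tendsto (mul_neg_of_pos_of_neg hc (sub_neg.2 (h k₀ hik₀ hk₀j))) ?_
  exact hstep j hij.le fun l hl => hgrow l (Finset.mem_Ico.1 hl).1 (Finset.mem_Ico.1 hl).2

theorem hProj_partialProducts (ω : ℕ → G n p) (i : Fin n) (m : ℕ) :
    hProj i (partialProducts ω m) = ∑ l ∈ Finset.range (m + 1), hProj i (ω l) := by
  induction m with
  | zero => simp [partialProducts]
  | succ m ih => rw [Finset.sum_range_succ, ← ih]; rfl

end Deterministic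

/-! ### The strong law and its consequences for the walk. -/

section Probability

/-- Needed because `partialProducts ω m` has `m + 1` factors. -/
theorem tendsto_shift_div {s : ℕ → ℝ} {c : ℝ} (h : Tendsto (fun m : ℕ => s m / m) atTop (𝓝 c)) :
    Tendsto (fun m : ℕ => s (m + 1) / m) atTop (𝓝 c) := by
  have h1 : Tendsto (fun m : ℕ => ((m + 1 : ℕ) : ℝ) / m) atTop (𝓝 1) := by
    have : Tendsto (fun m : ℕ => 1 + (1 : ℝ) / m) atTop (𝓝 (1 + 0)) :=
      tendsto_const_nhds.add tendsto_one_div_atTop_nhds_zero_nat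
    rw [add_zero] at this
    refine this.congr' ?_
    filter_upwards [eventually_gt_atTop 0] with m hm
    have : (m : ℝ) ≠ 0 := by exact_mod_cast hm.ne'
    push_cast
    field_simp
  have h2 := (h.comp (tendsto_add_atTop_nat 1)).mul h1
  rw [mul_one] at h2
  refine h2.congr fun m => ?_
  have : ((m + 1 : ℕ) : ℝ) ≠ 0 := by exact_mod_cast m.succ_ne_zero
  simp only [Function.comp_apply]
  field_simp

theorem strong_law_infinitePi {X : Type*} [MeasurableSpace X] (μ : Measure X)
    [IsProbabilityMeasure μ] {f : X → ℝ} (hf : Measurable f) (hint : Integrable f μ) :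
    ∀ᵐ ω ∂(Measure.infinitePi fun _ : ℕ => μ),
      Tendsto (fun m : ℕ => (∑ l ∈ Finset.range m, f (ω l)) / m) atTop (𝓝 (∫ x, f x ∂μ)) := by
  have hmp : ∀ l : ℕ, MeasurePreserving (Function.eval l)
      (Measure.infinitePi fun _ : ℕ => μ) μ := measurePreserving_eval_infinitePi _
  have h := ProbabilityTheory.strong_law_ae_real (μ := Measure.infinitePi fun _ : ℕ => μ)
    (fun l ω => f (ω l)) ((hmp 0).integrable_comp_of_integrable hint)
    (fun k l hkl => (ProbabilityTheory.iIndepFun_infinitePi (P := fun _ : ℕ => μ)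
      (X := fun _ => f) fun _ => hf).indepFun hkl)
    (fun l => by
      refine ⟨(hf.comp (hmp l).measurable).aemeasurable, (hf.comp (hmp 0).measurable).aemeasurable,
        ?_⟩
      change Measure.map (f ∘ fun ω : ℕ → X => ω l) _ = Measure.map (f ∘ fun ω : ℕ → X => ω 0) _
      rw [← Measure.map_map hf (measurable_pi_apply l), ← Measure.map_map hf (measurable_pi_apply 0)]
      exact congrArg (Measure.map f) ((hmp l).map_eq.trans (hmp 0).map_eq.symm))
  have hE : ∫ ω, f (ω 0) ∂(Measure.infinitePi fun _ : ℕ => μ) = ∫ x, f x ∂μ := by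
    have := integral_map (hmp 0).measurable.aemeasurable
      (hf.aestronglyMeasurable (μ := (Measure.infinitePi fun _ : ℕ => μ).map (Function.eval 0)))
    rw [(hmp 0).map_eq] at this
    exact this.symm
  rwa [hE] at h

variable {n p : ℕ} [Fact p.Prime]

theorem ae_wordLength_ne_top {μ : Measure (G n p)} (hmom : FiniteFirstMoment μ) :
    ∀ᵐ g ∂μ, wordLength (gens n p) g ≠ ⊤ := by
  filter_upwards [ae_lt_top (measurable_of_countable _) hmom.ne] with g hg h
  simp [h] at hg

theorem integrable_wordLength {μ : Measure (G n p)} (hmom : FiniteFirstMoment μ) :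
    Integrable (fun g => ((wordLength (gens n p) g : ℝ≥0∞)).toReal) μ :=
  integrable_toReal_of_lintegral_ne_top (measurable_of_countable _).aemeasurable hmom.ne

theorem integrable_hProj {μ : Measure (G n p)} (hmom : FiniteFirstMoment μ) (i : Fin n) :
    Integrable (fun g => (hProj i g : ℝ)) μ := by
  obtain ⟨K, A, hK, hA, hKA⟩ := exists_wordLength_bound n p
  refine ((integrable_wordLength hmom).const_mul K).mono'
    (measurable_of_countable _).aestronglyMeasurable ?_
  filter_upwards [ae_wordLength_ne_top hmom] with g hg
  obtain ⟨L, hL⟩ := ENat.ne_top_iff_exists.1 hg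
  rw [← hL]
  simpa using (hKA g L hL.symm).1 i

theorem integral_hProj (μ : Measure (G n p)) (i : Fin n) :
    ∫ g, (hProj i g : ℝ) ∂μ = mean μ i :=
  (integral_map (measurable_of_countable _).aemeasurable
    (measurable_of_countable _).aestronglyMeasurable).symm

theorem ae_exists_tendsto_realEntry (μ : Measure (G n p)) [IsProbabilityMeasure μ]
    (hmom : FiniteFirstMoment μ) {i j : Fin n} (hij : i < j)
    (h : ∀ k, i ≤ k → k < j → displacement μ k j < 0) :
    ∀ᵐ ω ∂(pathMeasure μ), ∃ l : ℝ, Tendsto (fun m : ℕ => realEntry (ω m) i j) atTop (𝓝 l) := by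
  -- Measurability lets the claim be pulled back along `partialProducts` to independent increments.
  have hmeas : MeasurableSet {ω : ℕ → G n p |
      ∃ l : ℝ, Tendsto (fun m : ℕ => realEntry (ω m) i j) atTop (𝓝 l)} :=
    measurableSet_exists_tendsto fun m =>
      (measurable_of_countable fun g : G n p => realEntry g i j).comp (measurable_pi_apply m)
  unfold pathMeasure
  rw [ae_map_iff (measurable_partialProducts n p).aemeasurable hmeas]
  obtain ⟨K, A, hK, hA, hKA⟩ := exists_wordLength_bound n p
  have h1 : ∀ᵐ ω ∂(Measure.infinitePi fun _ : ℕ => μ), ∀ k : Fin n,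
      Tendsto (fun m : ℕ => (∑ l ∈ Finset.range m, (hProj k (ω l) : ℝ)) / m) atTop
        (𝓝 (mean μ k)) := by
    refine ae_all_iff.2 fun k => ?_
    rw [← integral_hProj]
    exact strong_law_infinitePi μ (measurable_of_countable _) (integrable_hProj hmom k)
  have h2 := strong_law_infinitePi μ (measurable_of_countable _) (integrable_wordLength hmom)
  have h3 : ∀ᵐ ω ∂(Measure.infinitePi fun _ : ℕ => μ), ∀ m : ℕ,
      wordLength (gens n p) (ω m) ≠ ⊤ := ae_all_iff.2 fun m =>
    (measurePreserving_eval_infinitePi (fun _ : ℕ => μ) m).quasiMeasurePreserving.ae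
      (ae_wordLength_ne_top hmom)
  filter_upwards [h1, h2, h3] with ω h1 h2 h3
  refine exists_tendsto_realEntry (partialProducts ω) ω (fun _ => rfl) (mean μ) (fun k => ?_)
    (fun k l => ?_) hij (fun k hik hkj => sub_neg.1 (h k hik hkj))
  · refine (tendsto_shift_div (h1 k)).congr fun m => ?_
    rw [hProj_partialProducts]
    push_cast
    rfl
  · refine .of_log_le (u := fun m => Real.log A *
      ((wordLength (gens n p) (ω (m + 1)) : ℝ≥0∞)).toReal) (fun m => ?_) ?_
    · obtain ⟨L, hL⟩ := ENat.ne_top_iff_exists.1 (h3 (m + 1))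
      refine ((hKA _ L hL.symm).2 k l).trans_eq ?_
      rw [← hL, ← Real.rpow_natCast, Real.rpow_def_of_pos (by linarith)]
      simp
    · have hs := tendsto_shift_div h2
      -- The word length of the single increment `ω (m + 1)` is a difference of consecutive partial
      -- sums with the same linear speed, hence `o(m)`.
      have := ((tendsto_shift_div hs).sub hs).const_mul (Real.log A)
      rw [sub_self, mul_zero] at this
      refine this.congr fun m => ?_
      rw [← sub_div, Finset.sum_range_succ _ (m + 1), add_sub_cancel_left, mul_div_assoc]

end Probability

/-! ### The limit matrix and the conclusion. -/

/-- A matrix of limits of entries of elements of `G` is unitriangular. -/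
theorem exists_UT_of_tendsto {n p : ℕ} [Fact p.Prime] (g : ℕ → G n p)
    (h : ∀ i j : Fin n, i < j → ∃ l : ℝ, Tendsto (fun m => realEntry (g m) i j) atTop (𝓝 l)) :
    ∃ Φ : UT n ℝ, ∀ i j : Fin n,
      Tendsto (fun m => realEntry (g m) i j) atTop (𝓝 (entry Φ i j)) := by
  have h' : ∀ i j : Fin n, ∃ l : ℝ, Tendsto (fun m => realEntry (g m) i j) atTop (𝓝 l) ∧
      (i = j → l = 1) ∧ (j < i → l = 0) := by
    intro i j
    rcases lt_trichotomy i j with hij | rfl | hij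
    · obtain ⟨l, hl⟩ := h i j hij
      exact ⟨l, hl, fun e => absurd e hij.ne, fun e => absurd e hij.not_gt⟩
    · exact ⟨1, by simp only [realEntry_self]; exact tendsto_const_nhds, fun _ => rfl,
        fun e => absurd e (lt_irrefl _)⟩
    · exact ⟨0, by simp only [realEntry_of_lt _ hij]; exact tendsto_const_nhds,
        fun e => absurd e hij.ne', fun _ => rfl⟩
  choose l hl hdiag hlow using h'
  have hdet : (Matrix.of l).det = 1 := by
    rw [Matrix.det_of_isUpperTriangular (M := Matrix.of l) (fun i j hij => hlow i j hij)]
    exact Finset.prod_eq_one fun i _ => hdiag i i rfl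
  exact ⟨⟨Matrix.GeneralLinearGroup.mk'' (Matrix.of l) (by rw [hdet]; exact isUnit_one),
    fun i => hdiag i i rfl, fun i j hij => hlow i j hij⟩, hl⟩

end UTWalk

theorem mainTheorem7 (n p : ℕ) [Fact p.Prime] (μ : Measure (UTWalk.G n p))
    [IsProbabilityMeasure μ] (hmom : UTWalk.FiniteFirstMoment μ)
    (hna : UTWalk.NonabelianSupport μ) :
    (∀ i j : Fin n, i < j → UTWalk.displacement μ i j < 0 →
      (∀ k : Fin n, i < k → k < j →
        SignType.sign (UTWalk.displacement μ k j) = SignType.sign (UTWalk.displacement μ i j)) →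
      ∀ᵐ ω ∂(UTWalk.pathMeasure μ), ∃ l : ℝ,
        Tendsto (fun m : ℕ => UTWalk.realEntry (ω m) i j) atTop (𝓝 l)) ∧
    ((∀ i j : Fin n, i < j → UTWalk.displacement μ i j < 0) →
      ∀ᵐ ω ∂(UTWalk.pathMeasure μ), ∃ Φ : UTWalk.UT n ℝ, ∀ i j : Fin n,
        Tendsto (fun m : ℕ => UTWalk.realEntry (ω m) i j) atTop (𝓝 (UTWalk.entry Φ i j))) := by
  refine ⟨fun i j hij hneg hsign => ?_, fun hneg => ?_⟩
  · refine UTWalk.ae_exists_tendsto_realEntry μ hmom hij fun k hik hkj => ?_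
    rcases hik.eq_or_lt with rfl | hik
    · exact hneg
    -- The sign condition turns `D_ij < 0` into `D_kj < 0` for the intermediate `k`.
    · rw [← sign_eq_neg_one_iff, hsign k hik hkj, sign_eq_neg_one_iff]
      exact hneg
  · have h : ∀ᵐ ω ∂(UTWalk.pathMeasure μ), ∀ i j : Fin n, i < j → ∃ l : ℝ,
        Tendsto (fun m : ℕ => UTWalk.realEntry (ω m) i j) atTop (𝓝 l) := by
      simp only [ae_all_iff]
      exact fun i j hij => UTWalk.ae_exists_tendsto_realEntry μ hmom hij
        fun k _ hkj => hneg k j hkj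
    filter_upwards [h] with ω hω
    exact UTWalk.exists_UT_of_tendsto ω hω
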